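/- Let $\mathcal B$ be a small category, let $\mathcal G=\mathrm{Set}^{\mathcal B}$ be the category of functors $\mathcal B\to\mathrm{Set}$, and let $I$ be a finite directed multigraph (finitely many vertices and edges). A diagram $D:I\to\mathcal G$ assigns to each vertex $i$ an object $D_i$ of $\mathcal G$ and to each edge $d:i\to j$ a morphism $D_d:D_i\to D_j$. A natural transformation $\tau:E\Rightarrow D$ of diagrams is a family $\tau_i:E_i\to D_i$ with $\tau_j\circ E_d=D_d\circ\tau_i$ for every edge $d:i\to j$; it is cartesian if all these squares are pullbacks. Let $\kappa:D\Rightarrow\Delta S$ be a colimiting cocone of $D$. Pulling back along the components $\kappa_i$ defines a functor $\kappa^*$ from the slice category $\mathcal G/S$ to the full subcategory of the slice category $\mathcal G^I/D$ on the cartesian natural transformations, and $\kappa$ is called Van Kampen if $\kappa^*$ is an equivalence of categories. Let $X$ be an object of $\mathcal B$, and regard the sets $D_i(X)$ as pairwise disjoint. A path segment of sort $X$ is a triple $(y,\delta,y')$ where either $\delta=d$ is an edge $i\to j$ of $I$, $y\in D_i(X)$ and $y'=D_d(y)\in D_j(X)$, or $\delta=d^{op}$ is the formal opposite of such an edge,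 $y'\in D_i(X)$ and $y=D_d(y')\in D_j(X)$. Two segments are weakly equal if they are equal or one is the reverse $(y',\delta^{op},y)$ of the other $(y,\delta,y')$, where $(d^{op})^{op}=d$. A mapping path of sort $X$ from $z$ to $z'$ is a finite sequence $[(y_0,\delta_0,y_1),(y_1,\delta_1,y_2),\dots,(y_{n-1},\delta_{n-1},y_n)]$ of path segments of sort $X$ with $n\ge 1$, $y_0=z$ and $y_n=z'$, or, if $z=z'$, the empty sequence ($n=0$). It is proper if the segments at any two different positions are not weakly equal, and inner-cycle free if $y_i\ne y_j$ whenever $0\le i<j\le n$ and $j-i\le n-1$. Two mapping paths are disjoint if no segment of the one is weakly equal to a segment of the other. The following are equivalent: 1. $\kappa$ is Van Kampen. 2. For all objects $X$ of $\mathcal B$, all vertices $i,j$ of $I$ and all $z\in D_i(X)$, $z'\in D_j(X)$, there are no two different proper mapping paths from $z$ to $z'$. 3. For all such $X,i,j,z,z'$, there are no two different proper mapping paths from $z$ to $z'$ that are disjoint. 4. For all such $X,i,j,z,z'$, there are no two different proper mapping paths from $z$ to $z'$ that are disjoint and both inner-cycle free. -/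

import Mathlib

open CategoryTheory

universe u v w₁ w₂ u₁ v₁

namespace VanKampenPath

/-! ### Diagrams over a multigraph

A directed multigraph is a quiver `I`; a diagram in `C` is a graph morphism `I ⥤q C` into the
underlying graph of `C`. -/

section Diagrams

variable {I : Type w₁} [Quiver.{w₂} I] {C : Type u₁} [Category.{v₁} C]

/-- A natural transformation between diagrams: one component for each vertex, and one naturality
square for each edge. -/
@[ext]
structure DiagramHom (E D : I ⥤q C) where
  app (i : I) : E.obj i ⟶ D.obj i
  naturality {i j : I} (d : i ⟶ j) : E.map d ≫ app j = app i ≫ D.map d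

/-- The category of diagrams over the multigraph `I` in `C`. -/
instance diagramCategory : Category (I ⥤q C) where
  Hom := DiagramHom
  id D := { app := fun i => 𝟙 (D.obj i), naturality := by simp }
  comp σ τ :=
    { app := fun i => σ.app i ≫ τ.app i
      naturality := fun d => by
        rw [← Category.assoc, σ.naturality, Category.assoc, τ.naturality, Category.assoc] }
  id_comp τ := by ext; simp
  comp_id τ := by ext; simp
  assoc ρ σ τ := by ext; simp

@[ext]
theorem diagramHom_ext {E D : I ⥤q C} {σ τ : E ⟶ D} (h : ∀ i, σ.app i = τ.app i) : σ = τ :=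
  DiagramHom.ext (funext h)

@[simp]
theorem id_app (D : I ⥤q C) (i : I) : DiagramHom.app (𝟙 D) i = 𝟙 (D.obj i) := rfl

@[simp]
theorem comp_app {F E D : I ⥤q C} (σ : F ⟶ E) (τ : E ⟶ D) (i : I) :
    (σ ≫ τ).app i = σ.app i ≫ τ.app i := rfl

/-- The constant diagram at `S`, sending each edge to the identity of `S`. -/
@[simps]
def constDiagram (I : Type w₁) [Quiver.{w₂} I] (S : C) : I ⥤q C where
  obj _ := S
  map _ := 𝟙 S

/-- A commutative cocone over `D` with vertex `S` is a natural transformation from `D` to the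
constant diagram at `S`. -/
abbrev DiagramCocone (D : I ⥤q C) (S : C) := D ⟶ constDiagram I S

/-- The component at `i` of a cocone, as a morphism to its vertex. -/
def leg {D : I ⥤q C} {S : C} (κ : DiagramCocone D S) (i : I) : D.obj i ⟶ S := κ.app i

theorem leg_w {D : I ⥤q C} {S : C} (κ : DiagramCocone D S) {i j : I} (d : i ⟶ j) :
    D.map d ≫ leg κ j = leg κ i :=
  (κ.naturality d).trans (Category.comp_id _)

/-- A cocone is colimiting if it is universal. -/
def IsColimiting {D : I ⥤q C} {S : C} (κ : DiagramCocone D S) : Prop :=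
  ∀ (T : C) (ρ : DiagramCocone D T), ∃! u : S ⟶ T, ∀ i : I, leg κ i ≫ u = leg ρ i

/-- A natural transformation is cartesian if all its naturality squares are pullbacks. -/
def IsCartesian {E D : I ⥤q C} (τ : E ⟶ D) : Prop :=
  ∀ ⦃i j : I⦄ (d : i ⟶ j), IsPullback (E.map d) (τ.app i) (τ.app j) (D.map d)

/-- The full subcategory of the slice category over `D` on the cartesian transformations. -/
abbrev CartesianOver (D : I ⥤q C) :=
  ObjectProperty.FullSubcategory (fun τ : Over D => IsCartesian τ.hom)

variable [Limits.HasPullbacks C]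

/-- The diagram obtained by pulling back `σ : K ⟶ S` along all components of the cocone `κ`. -/
noncomputable def pullbackDiagram {D : I ⥤q C} {S : C} (κ : DiagramCocone D S) (σ : Over S) :
    I ⥤q C where
  obj i := Limits.pullback (leg κ i) σ.hom
  map {i j} d := Limits.pullback.lift
    (Limits.pullback.fst (leg κ i) σ.hom ≫ D.map d)
    (Limits.pullback.snd (leg κ i) σ.hom)
    (by rw [Category.assoc, leg_w κ d]; exact Limits.pullback.condition)

section PullbackDiagram

variable {D : I ⥤q C} {S : C} (κ : DiagramCocone D S) (σ : Over S)

/-- The projection of the pullback of `σ` along `leg κ i` to `D.obj i`. -/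
noncomputable def pbFst (i : I) : (pullbackDiagram κ σ).obj i ⟶ D.obj i :=
  Limits.pullback.fst (leg κ i) σ.hom

/-- The projection of the pullback of `σ` along `leg κ i` to the domain of `σ`. -/
noncomputable def pbSnd (i : I) : (pullbackDiagram κ σ).obj i ⟶ σ.left :=
  Limits.pullback.snd (leg κ i) σ.hom

theorem pb_isPullback (i : I) : IsPullback (pbSnd κ σ i) (pbFst κ σ i) σ.hom (leg κ i) :=
  (IsPullback.of_hasPullback (leg κ i) σ.hom).flip

theorem map_pbFst {i j : I} (d : i ⟶ j) :
    (pullbackDiagram κ σ).map d ≫ pbFst κ σ j = pbFst κ σ i ≫ D.map d :=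
  Limits.pullback.lift_fst _ _ _

theorem map_pbSnd {i j : I} (d : i ⟶ j) :
    (pullbackDiagram κ σ).map d ≫ pbSnd κ σ j = pbSnd κ σ i :=
  Limits.pullback.lift_snd _ _ _

/-- The transformation whose component at `i` is the pullback of `σ` along `leg κ i`. -/
noncomputable def pullbackProj : pullbackDiagram κ σ ⟶ D where
  app i := pbFst κ σ i
  naturality d := map_pbFst κ σ d

theorem pullbackProj_isCartesian : IsCartesian (pullbackProj κ σ) := by
  intro i j d
  refine IsPullback.of_right ?_ (map_pbFst κ σ d) (pb_isPullback κ σ j)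
  rw [map_pbSnd, leg_w]
  exact pb_isPullback κ σ i

variable {σ} {σ' : Over S} (γ : σ ⟶ σ')

/-- The component at `i` of the action of pulling back along `κ` on a morphism of the slice
category over `S`: the universal arrow into the pullback. -/
noncomputable def pbMap (i : I) : (pullbackDiagram κ σ).obj i ⟶ (pullbackDiagram κ σ').obj i :=
  (pb_isPullback κ σ' i).lift (pbSnd κ σ i ≫ γ.left) (pbFst κ σ i)
    (by rw [Category.assoc, Over.w]; exact (pb_isPullback κ σ i).w)

@[simp]
theorem pbMap_pbFst (i : I) : pbMap κ γ i ≫ pbFst κ σ' i = pbFst κ σ i :=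
  (pb_isPullback κ σ' i).lift_snd _ _ _

@[simp]
theorem pbMap_pbSnd (i : I) : pbMap κ γ i ≫ pbSnd κ σ' i = pbSnd κ σ i ≫ γ.left :=
  (pb_isPullback κ σ' i).lift_fst _ _ _

/-- The action of pulling back along `κ` on a morphism of the slice category over `S`. -/
noncomputable def pullbackMap : pullbackDiagram κ σ ⟶ pullbackDiagram κ σ' where
  app i := pbMap κ γ i
  naturality {i j} d := by
    apply (pb_isPullback κ σ' j).hom_ext
    · rw [Category.assoc, Category.assoc, pbMap_pbSnd, map_pbSnd, pbMap_pbSnd,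
        ← Category.assoc, map_pbSnd]
    · rw [Category.assoc, Category.assoc, pbMap_pbFst, map_pbFst, map_pbFst,
        ← Category.assoc, pbMap_pbFst]

end PullbackDiagram

/-- The functor pulling back along the cocone `κ`, from the slice category over `S` to the
category of cartesian transformations into `D`. -/
noncomputable def pullbackAlong {D : I ⥤q C} {S : C} (κ : DiagramCocone D S) :
    Over S ⥤ CartesianOver D where
  obj σ := ⟨Over.mk (pullbackProj κ σ), pullbackProj_isCartesian κ σ⟩
  map γ := ObjectProperty.homMk (Over.homMk (pullbackMap κ γ) (by
    ext i
    exact pbMap_pbFst κ γ i))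
  map_id σ := by
    ext i
    change pbMap κ (𝟙 σ) i = 𝟙 _
    apply (pb_isPullback κ σ i).hom_ext <;> simp
  map_comp {_ _ σ''} γ γ' := by
    ext i
    change pbMap κ (γ ≫ γ') i = pbMap κ γ i ≫ pbMap κ γ' i
    apply (pb_isPullback κ σ'' i).hom_ext
    · rw [Category.assoc, pbMap_pbSnd, pbMap_pbSnd, ← Category.assoc, pbMap_pbSnd,
        Over.comp_left, Category.assoc]
    · simp

/-- A cocone is Van Kampen if pulling back along it is an equivalence of categories. -/
def IsVanKampen {D : I ⥤q C} {S : C} (κ : DiagramCocone D S) : Prop :=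
  (pullbackAlong κ).IsEquivalence

end Diagrams

/-! ### Mapping paths -/

section Paths

variable {I : Type w₁} [Quiver.{w₂} I] {B : Type u} [SmallCategory.{u} B]

/-- The elements of sort `X` of a diagram of presheaves: the disjoint union of the sets
`D_i(X)`. -/
abbrev Element (D : I ⥤q (B ⥤ Type u)) (X : B) := Σ i : I, (D.obj i).obj X

/-- The edges `d` of `I` together with their formal opposites. -/
inductive SignedEdge (I : Type w₁) [Quiver.{w₂} I] : Type (max w₁ w₂)
  | fwd {i j : I} (d : i ⟶ j) : SignedEdge I
  | bwd {i j : I} (d : i ⟶ j) : SignedEdge I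

/-- The formal opposite of a signed edge. -/
def SignedEdge.op : SignedEdge I → SignedEdge I
  | fwd d => bwd d
  | bwd d => fwd d

/-- `MapsTo d y y'` says that `y` is an element of the source component of the edge `d`, and that
`D_d` maps it to `y'`. -/
def MapsTo (D : I ⥤q (B ⥤ Type u)) {X : B} {i j : I} (d : i ⟶ j) (y y' : Element D X) : Prop :=
  ∃ x : (D.obj i).obj X, y = ⟨i, x⟩ ∧ y' = ⟨j, (D.map d).app X x⟩

/-- The condition on a triple `(y, δ, y')` to be a path segment. -/
def IsSegment (D : I ⥤q (B ⥤ Type u)) {X : B} (y : Element D X) (δ : SignedEdge I)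
    (y' : Element D X) : Prop :=
  match δ with
  | .fwd d => MapsTo D d y y'
  | .bwd d => MapsTo D d y' y

/-- Path segments of sort `X`. -/
@[ext]
structure PathSegment (D : I ⥤q (B ⥤ Type u)) (X : B) where
  first : Element D X
  label : SignedEdge I
  third : Element D X
  valid : IsSegment D first label third

variable {D : I ⥤q (B ⥤ Type u)} {X : B}

/-- The path segment `(y', δ.op, y)` obtained from `(y, δ, y')`. -/
def PathSegment.reverse (s : PathSegment D X) : PathSegment D X where
  first := s.third
  label := s.label.op
  third := s.first
  valid := by
    obtain ⟨y, δ, y', h⟩ := s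
    cases δ <;> exact h

/-- Weak equality of path segments: equality up to reversal. -/
def WeaklyEqual (s t : PathSegment D X) : Prop := s = t ∨ s = t.reverse

/-- `Connects P z z'` says that the sequence `P` of path segments is a mapping path, i.e. the third
component of each segment is the first component of its successor, and that it connects `z` with
`z'`. The empty path connects each element with itself. -/
def Connects : List (PathSegment D X) → Element D X → Element D X → Prop
  | [], z, z' => z = z'
  | s :: P, z, z' => s.first = z ∧ Connects P s.third z'

/-- A path is proper if its segments at any two different positions are not weakly equal. -/
def IsProper (P : List (PathSegment D X)) : Prop := P.Pairwise fun s t => ¬ WeaklyEqual s t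

/-- No segment of `P` is weakly equal to a segment of `Q`. -/
def PathsDisjoint (P Q : List (PathSegment D X)) : Prop :=
  ∀ s ∈ P, ∀ t ∈ Q, ¬ WeaklyEqual s t

/-- The list `y₀, y₁, …, yₙ` of the elements visited by a non-empty path. -/
def pathElements : List (PathSegment D X) → List (Element D X)
  | [] => []
  | s :: P => s.first :: (s :: P).map PathSegment.third

/-- A path of length `n` is inner-cycle free if `yᵢ ≠ yⱼ` for all `0 ≤ i < j ≤ n` with
`j - i ≤ n - 1`. -/
def IsInnerCycleFree (P : List (PathSegment D X)) : Prop :=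
  ∀ i j : ℕ, i < j → j ≤ P.length → j < i + P.length →
    (pathElements P)[i]? ≠ (pathElements P)[j]?

end Paths

end VanKampenPath

namespace VanKampenPath

/-! ### Trails in the graph of elements -/

section PathCombinatorics

variable {I : Type w₁} [Quiver.{w₂} I] {B : Type u} [SmallCategory.{u} B]
  {D : I ⥤q (B ⥤ Type u)} {X : B}

/-! For each sort `X` the elements of `D` form a graph whose edges are the path segments up to
reversal, and proper paths are its trails. All four conditions say that each of these graphs is a
forest, here `NoProperCycle`.

A cartesian transformation into `D` acts as a covering of these graphs: paths lift
(`IsCartesian.exists_lift`). It is a pullback from the colimit only if it has trivial monodromy. In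
a forest this is automatic (`IsCartesian.eq_of_connects`): the projection of a path either is a
trail or has a repeated segment that lets the path be shortened. This gives essential surjectivity;
full faithfulness holds for every colimiting cocone, since colimits of set-valued functors are
universal (`IsColimiting.pullbackCocone`).

Conversely, a closed trail through a segment `s` is detected by the double cover that swaps its
sheets exactly along `s` (`twistedDiagram`). One turn around the trail changes the sheet, which no
transformation pulled back along `κ` allows (`IsVanKampen.noProperCycle`).

The combinatorial link is that two different parallel trails yield a closed trail
(`NoProperCycle.eq_of_connects`), while a closed trail contains an inner-cycle free one
(`exists_isInnerCycleFree`), which is parallel to the empty path. -/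

theorem SignedEdge.op_op (δ : SignedEdge I) : δ.op.op = δ := by cases δ <;> rfl

@[simp]
theorem PathSegment.reverse_reverse (s : PathSegment D X) : s.reverse.reverse = s :=
  PathSegment.ext rfl (SignedEdge.op_op _) rfl

theorem WeaklyEqual.symm {s t : PathSegment D X} (h : WeaklyEqual s t) : WeaklyEqual t s := by
  rcases h with rfl | rfl
  · exact Or.inl rfl
  · exact Or.inr (PathSegment.reverse_reverse t).symm

theorem weaklyEqual_reverse_right {s t : PathSegment D X} :
    WeaklyEqual s t.reverse ↔ WeaklyEqual s t := by
  simp only [WeaklyEqual, PathSegment.reverse_reverse]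
  exact or_comm

theorem weaklyEqual_reverse_left {s t : PathSegment D X} :
    WeaklyEqual s.reverse t ↔ WeaklyEqual s t :=
  ⟨fun h => (weaklyEqual_reverse_right.1 h.symm).symm,
    fun h => (weaklyEqual_reverse_right.2 h.symm).symm⟩

theorem Connects.append {P Q : List (PathSegment D X)} {x y z : Element D X}
    (hP : Connects P x y) (hQ : Connects Q y z) : Connects (P ++ Q) x z := by
  induction P generalizing x with
  | nil => cases hP; exact hQ
  | cons s P ih => exact ⟨hP.1, ih hP.2⟩

theorem connects_append {P Q : List (PathSegment D X)} {x z : Element D X} :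
    Connects (P ++ Q) x z ↔ ∃ y, Connects P x y ∧ Connects Q y z := by
  refine ⟨fun h => ?_, fun ⟨y, hP, hQ⟩ => hP.append hQ⟩
  induction P generalizing x with
  | nil => exact ⟨x, rfl, h⟩
  | cons s P ih =>
    obtain ⟨y, h₁, h₂⟩ := ih h.2
    exact ⟨y, ⟨h.1, h₁⟩, h₂⟩

theorem connects_singleton (s : PathSegment D X) : Connects [s] s.first s.third := ⟨rfl, rfl⟩

/-- A path through a segment `s` splits into a path to the source of `s` and a path from the
target of `s`. -/
theorem connects_append_cons {P Q : List (PathSegment D X)} {s : PathSegment D X}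
    {x z : Element D X} :
    Connects (P ++ s :: Q) x z ↔ Connects P x s.first ∧ Connects Q s.third z := by
  rw [connects_append]
  constructor
  · rintro ⟨y, h₁, rfl, h₂⟩
    exact ⟨h₁, h₂⟩
  · rintro ⟨h₁, h₂⟩
    exact ⟨_, h₁, rfl, h₂⟩

/-- The path traversed in the opposite direction. -/
def reversePath (P : List (PathSegment D X)) : List (PathSegment D X) :=
  (P.map PathSegment.reverse).reverse

theorem Connects.reversePath {P : List (PathSegment D X)} {x y : Element D X}
    (hP : Connects P x y) : Connects (reversePath P) y x := by
  induction P generalizing x with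
  | nil => exact Eq.symm hP
  | cons s P ih =>
    obtain ⟨rfl, h⟩ := hP
    simp only [VanKampenPath.reversePath, List.map_cons, List.reverse_cons]
    exact (ih h).append (connects_singleton s.reverse)

theorem IsProper.reversePath {P : List (PathSegment D X)} (hP : IsProper P) :
    IsProper (reversePath P) := by
  unfold IsProper VanKampenPath.reversePath at *
  rw [List.pairwise_reverse, List.pairwise_map]
  refine hP.imp fun h h' => h ?_
  exact (weaklyEqual_reverse_left.1 (weaklyEqual_reverse_right.1 h')).symm

theorem IsProper.sublist {P Q : List (PathSegment D X)} (hQ : IsProper Q) (h : P.Sublist Q) :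
    IsProper P :=
  List.Pairwise.sublist h hQ

/-- The graph of elements of sort `X` has no nonempty closed trail. -/
def NoProperCycle (D : I ⥤q (B ⥤ Type u)) (X : B) : Prop :=
  ∀ (P : List (PathSegment D X)) (z : Element D X), Connects P z z → IsProper P → P = []

/-- Without closed trails, trails are determined by their endpoints. -/
theorem NoProperCycle.eq_of_connects (h : NoProperCycle D X) (P Q : List (PathSegment D X))
    {z z' : Element D X} (hP : Connects P z z') (hQ : Connects Q z z')
    (hP' : IsProper P) (hQ' : IsProper Q) : P = Q := by
  by_cases hd : PathsDisjoint P Q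
  -- Going out along `P` and back along `Q` is a closed trail.
  · have h₁ : P ++ reversePath Q = [] := by
      refine h _ z (hP.append hQ.reversePath) (List.pairwise_append.2 ⟨hP', hQ'.reversePath, ?_⟩)
      intro s hs t ht hst
      simp only [VanKampenPath.reversePath, List.mem_reverse, List.mem_map] at ht
      obtain ⟨t, ht, rfl⟩ := ht
      exact hd s hs t ht (weaklyEqual_reverse_right.1 hst)
    simp only [VanKampenPath.reversePath, List.append_eq_nil_iff, List.reverse_eq_nil_iff,
      List.map_eq_nil_iff] at h₁
    rw [h₁.1, h₁.2]
  · simp only [PathsDisjoint, not_forall, not_not] at hd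
    obtain ⟨s, hs, t, ht, hst⟩ := hd
    obtain ⟨P₁, P₂, rfl⟩ := List.append_of_mem hs
    obtain ⟨Q₁, Q₂, rfl⟩ := List.append_of_mem ht
    have hP₁ := connects_append_cons.1 hP
    have hQ₁ := connects_append_cons.1 hQ
    -- A common segment traversed in the same direction leaves parallel prefixes and parallel
    -- suffixes. In opposite directions, `P₁ ++ [s]` is parallel to `Q₁` and `P₁` to `Q₁ ++ [t]`, so
    -- induction yields incompatible lengths.
    rcases hst with rfl | hst
    · have e₁ : P₁ = Q₁ := h.eq_of_connects P₁ Q₁ hP₁.1 hQ₁.1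
        (hP'.sublist (List.sublist_append_left _ _)) (hQ'.sublist (List.sublist_append_left _ _))
      have e₂ : P₂ = Q₂ := h.eq_of_connects P₂ Q₂ hP₁.2 hQ₁.2
        (hP'.sublist ((List.sublist_cons_self _ _).trans (List.sublist_append_right _ _)))
        (hQ'.sublist ((List.sublist_cons_self _ _).trans (List.sublist_append_right _ _)))
      rw [e₁, e₂]
    · have f₁ : s.first = t.third := by rw [hst]; rfl
      have f₂ : s.third = t.first := by rw [hst]; rfl
      have e₁ : P₁ ++ [s] = Q₁ := h.eq_of_connects (P₁ ++ [s]) Q₁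
        (connects_append_cons.2 ⟨hP₁.1, f₂⟩) hQ₁.1
        (hP'.sublist (List.Sublist.append_left (by simp) _))
        (hQ'.sublist (List.sublist_append_left _ _))
      have e₂ : P₁ = Q₁ ++ [t] := h.eq_of_connects P₁ (Q₁ ++ [t])
        hP₁.1 (connects_append_cons.2 ⟨hQ₁.1, f₁.symm⟩)
        (hP'.sublist (List.sublist_append_left _ _))
        (hQ'.sublist (List.Sublist.append_left (by simp) _))
      have l₁ := congrArg List.length e₁
      have l₂ := congrArg List.length e₂
      simp at l₁ l₂
      omega
termination_by P.length + Q.length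
decreasing_by
  all_goals
    subst_vars
    simp only [List.length_append, List.length_cons, List.length_nil]
    omega

theorem pathElements_eq {P : List (PathSegment D X)} {z z' : Element D X} (hP : Connects P z z')
    (hne : P ≠ []) : pathElements P = z :: P.map PathSegment.third := by
  cases P with
  | nil => exact absurd rfl hne
  | cons s P => obtain ⟨rfl, _⟩ := hP; rfl

theorem Connects.exists_split {P : List (PathSegment D X)} {z z' : Element D X}
    (hP : Connects P z z') {n : ℕ} (hn : n ≤ P.length) :
    ∃ y, (z :: P.map PathSegment.third)[n]? = some y ∧ Connects (P.take n) z y ∧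
      Connects (P.drop n) y z' := by
  induction P generalizing z n with
  | nil =>
    obtain rfl : n = 0 := by simpa using hn
    exact ⟨z, rfl, rfl, hP⟩
  | cons s P ih =>
    cases n with
    | zero => exact ⟨z, rfl, rfl, hP⟩
    | succ n =>
      obtain ⟨y, h₁, h₂, h₃⟩ := ih hP.2 (n := n) (by simpa using hn)
      exact ⟨y, by simpa using h₁, ⟨hP.1, h₂⟩, h₃⟩

/-- A closed trail contains an inner-cycle free closed trail. -/
theorem exists_isInnerCycleFree (P : List (PathSegment D X)) {z : Element D X}
    (hP : Connects P z z) (hP' : IsProper P) (hne : P ≠ []) :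
    ∃ (Q : List (PathSegment D X)) (y : Element D X),
      Connects Q y y ∧ IsProper Q ∧ Q ≠ [] ∧ IsInnerCycleFree Q := by
  by_cases hc : IsInnerCycleFree P
  · exact ⟨P, z, hP, hP', hne, hc⟩
  · simp only [IsInnerCycleFree, not_forall, ne_eq, not_not] at hc
    obtain ⟨i, j, hij, hj, hl, he⟩ := hc
    obtain ⟨y, hy, h₁, -⟩ := hP.exists_split hj
    -- The piece between two visits to the same element is again a closed trail, strictly shorter
    -- because `j - i < P.length`.
    obtain ⟨x, hx, -, h₂⟩ := h₁.exists_split (n := i) (by simp; omega)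
    have hx' : (z :: P.map PathSegment.third)[i]? = some x := by
      rw [← hx, List.map_take, ← List.take_succ_cons, List.getElem?_take_of_lt (by omega)]
    rw [pathElements_eq hP hne, hx', hy, Option.some_inj] at he
    subst he
    have hlen : ((P.take j).drop i).length = j - i := by
      rw [List.length_drop, List.length_take, min_eq_left hj]
    exact exists_isInnerCycleFree ((P.take j).drop i) h₂
      (hP'.sublist ((List.drop_sublist _ _).trans (List.take_sublist _ _)))
      (fun h0 => by rw [h0] at hlen; simp at hlen; omega)
termination_by P.length
decreasing_by rw [hlen]; omega

end PathCombinatorics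

/-! ### Cocones, elements and path lifting -/

section Cocones

variable {I : Type w₁} [Quiver.{w₂} I] {C : Type u₁} [Category.{v₁} C]

/-- The cocone with given legs. -/
def mkCocone {D : I ⥤q C} {S : C} (l : ∀ i, D.obj i ⟶ S)
    (w : ∀ {i j : I} (d : i ⟶ j), D.map d ≫ l j = l i) : DiagramCocone D S where
  app := l
  naturality d := (w d).trans (Category.comp_id _).symm

end Cocones

section Elements

variable {I : Type w₁} [Quiver.{w₂} I] {B : Type u} [SmallCategory.{u} B]
  {D E : I ⥤q (B ⥤ Type u)} {X : B}

/-- The forward segment starting at `x` along the edge `d`. -/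
def edgeSegment (D : I ⥤q (B ⥤ Type u)) {X : B} {i j : I} (d : i ⟶ j) (x : (D.obj i).obj X) :
    PathSegment D X where
  first := ⟨i, x⟩
  label := .fwd d
  third := ⟨j, (D.map d).app X x⟩
  valid := ⟨x, rfl, rfl⟩

theorem PathSegment.eq_edgeSegment (s : PathSegment D X) :
    ∃ (i j : I) (d : i ⟶ j) (x : (D.obj i).obj X),
      s = edgeSegment D d x ∨ s = (edgeSegment D d x).reverse := by
  obtain ⟨y, δ, y', h⟩ := s
  cases δ with
  | fwd d =>
    obtain ⟨x, rfl, rfl⟩ := h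
    exact ⟨_, _, d, x, Or.inl rfl⟩
  | bwd d =>
    obtain ⟨x, rfl, rfl⟩ := h
    exact ⟨_, _, d, x, Or.inr rfl⟩

/-- The action of a transformation of diagrams on elements. -/
def mapElement (τ : E ⟶ D) (e : Element E X) : Element D X := ⟨e.1, (τ.app e.1).app X e.2⟩

/-- The value of a cocone at an element. -/
def coconeValue {S : B ⥤ Type u} (κ : DiagramCocone D S) (e : Element D X) : S.obj X :=
  (leg κ e.1).app X e.2

theorem coconeValue_edge {S : B ⥤ Type u} (κ : DiagramCocone D S) {i j : I} (d : i ⟶ j)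
    (x : (D.obj i).obj X) :
    (leg κ j).app X ((D.map d).app X x) = (leg κ i).app X x := by
  rw [← leg_w κ d]; rfl

theorem PathSegment.coconeValue_eq {S : B ⥤ Type u} (κ : DiagramCocone D S)
    (s : PathSegment D X) : coconeValue κ s.first = coconeValue κ s.third := by
  obtain ⟨i, j, d, x, rfl | rfl⟩ := s.eq_edgeSegment
  · exact (coconeValue_edge κ d x).symm
  · exact coconeValue_edge κ d x

theorem Connects.coconeValue_eq {S : B ⥤ Type u} (κ : DiagramCocone D S)
    {P : List (PathSegment D X)} {z z' : Element D X} (hP : Connects P z z') :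
    coconeValue κ z = coconeValue κ z' := by
  induction P generalizing z with
  | nil => cases hP; rfl
  | cons s P ih =>
    obtain ⟨rfl, h⟩ := hP
    exact (s.coconeValue_eq κ).trans (ih h)

theorem naturality_apply (τ : E ⟶ D) {i j : I} (d : i ⟶ j) (x : (E.obj i).obj X) :
    (τ.app j).app X ((E.map d).app X x) = (D.map d).app X ((τ.app i).app X x) :=
  ConcreteCategory.congr_hom (NatTrans.congr_app (τ.naturality d) X) x

/-- The image of a path segment under a transformation of diagrams. -/
def PathSegment.map (τ : E ⟶ D) (s : PathSegment E X) : PathSegment D X where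
  first := mapElement τ s.first
  label := s.label
  third := mapElement τ s.third
  valid := by
    obtain ⟨y, δ, y', h⟩ := s
    cases δ <;> obtain ⟨x, rfl, rfl⟩ := h <;>
      exact ⟨(τ.app _).app X x, rfl, Sigma.ext rfl (heq_of_eq (naturality_apply τ _ x))⟩

theorem Connects.map (τ : E ⟶ D) {P : List (PathSegment E X)} {z z' : Element E X}
    (hP : Connects P z z') :
    Connects (P.map (PathSegment.map τ)) (mapElement τ z) (mapElement τ z') := by
  induction P generalizing z with
  | nil => cases hP; rfl
  | cons s P ih =>
    obtain ⟨rfl, h⟩ := hP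
    exact ⟨rfl, ih h⟩

/-- Pullbacks of functors are computed pointwise, and in sets a commutative square is a pullback
when its projections are jointly injective and reach every compatible pair. -/
theorem isCartesian_iff (τ : E ⟶ D) : IsCartesian τ ↔
    ∀ ⦃i j : I⦄ (d : i ⟶ j) (X : B),
      (∀ e e' : (E.obj i).obj X, (E.map d).app X e = (E.map d).app X e' →
        (τ.app i).app X e = (τ.app i).app X e' → e = e') ∧
      ∀ (e : (E.obj j).obj X) (x : (D.obj i).obj X), (τ.app j).app X e = (D.map d).app X x →
        ∃ e' : (E.obj i).obj X, (E.map d).app X e' = e ∧ (τ.app i).app X e' = x := by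
  refine forall₃_congr fun i j d => ?_
  rw [IsPullback.iff_app]
  refine forall_congr' fun X => ?_
  rw [Limits.Types.isPullback_iff]
  constructor
  · rintro ⟨-, h₁, h₂⟩
    exact ⟨fun e e' h h' => h₁ e e' ⟨h, h'⟩, h₂⟩
  · rintro ⟨h₁, h₂⟩
    exact ⟨NatTrans.congr_app (τ.naturality d) X, fun e e' h => h₁ e e' h.1 h.2, h₂⟩

/-- Paths lift along cartesian transformations. -/
theorem IsCartesian.exists_lift {τ : E ⟶ D} (hτ : IsCartesian τ) {P : List (PathSegment D X)}
    (e : Element E X) {z : Element D X} (hP : Connects P (mapElement τ e) z) :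
    ∃ (Q : List (PathSegment E X)) (e' : Element E X), Connects Q e e' ∧ mapElement τ e' = z := by
  induction P generalizing e with
  | nil => exact ⟨[], e, rfl, hP⟩
  | cons s P ih =>
    obtain ⟨hs, h⟩ := hP
    have key : ∃ t : PathSegment E X, t.first = e ∧ mapElement τ t.third = s.third := by
      -- A forward segment lifts by naturality alone; a backward one needs the existence half of the
      -- pullback property.
      obtain ⟨i, j, d, x, rfl | rfl⟩ := s.eq_edgeSegment
      · obtain ⟨k, e⟩ := e
        obtain ⟨rfl, hx⟩ := Sigma.mk.inj_iff.1 hs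
        cases hx
        exact ⟨edgeSegment E d e, rfl, Sigma.ext rfl (heq_of_eq (naturality_apply τ d e))⟩
      · obtain ⟨k, e⟩ := e
        obtain ⟨rfl, hx⟩ := Sigma.mk.inj_iff.1 hs
        obtain ⟨e', rfl, rfl⟩ :=
          (((isCartesian_iff τ).1 hτ) d X).2 e x (eq_of_heq hx).symm
        exact ⟨(edgeSegment E d e').reverse, rfl, rfl⟩
    obtain ⟨t, rfl, ht⟩ := key
    obtain ⟨Q, e', hQ, he'⟩ := ih t.third (ht ▸ h)
    exact ⟨t :: Q, e', ⟨rfl, hQ⟩, he'⟩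

end Elements

/-! ### Closed trails obstruct the Van Kampen property -/

section Monodromy

variable {I : Type w₁} [Quiver.{w₂} I] {B : Type u} [SmallCategory.{u} B]
  {D : I ⥤q (B ⥤ Type u)} {X₀ : B}

/-- Whether the edge `d` at `x` is the segment `s`, up to reversal. -/
noncomputable def isMarked (s : PathSegment D X₀) {i j : I} (d : i ⟶ j)
    (x : (D.obj i).obj X₀) : Bool :=
  open Classical in decide (WeaklyEqual s (edgeSegment D d x))

/-- The double cover of the graph of elements of sort `X₀` that is twisted along the segment `s`,
extended to a cartesian diagram over `D` by right Kan extension. -/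
noncomputable def twistedDiagram (s : PathSegment D X₀) : I ⥤q (B ⥤ Type u) where
  obj i :=
    -- At sort `X₀` the coordinate `𝟙 X₀` is the sheet of the double cover. The remaining
    -- coordinates make the fibres functorial in `Y`.
    { obj := fun Y => (D.obj i).obj Y × ((Y ⟶ X₀) → Bool)
      map := fun f => TypeCat.ofHom fun p => ((D.obj i).map f p.1, fun g => p.2 (f ≫ g))
      map_id := fun Y => by ext p <;> simp
      map_comp := fun f g => by ext p <;> simp }
  map {i j} d :=
    { app := fun Y => TypeCat.ofHom fun p =>
        ((D.map d).app Y p.1, fun g => xor (p.2 g) (isMarked s d ((D.obj i).map g p.1)))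
      naturality := fun Y Z f => by
        ext p
        · exact NatTrans.naturality_apply (D.map d) f p.1
        · simp }

/-- The projection of the twisted diagram. -/
noncomputable def twistedProj (s : PathSegment D X₀) : twistedDiagram s ⟶ D where
  app i := { app := fun Y => TypeCat.ofHom Prod.fst }
  naturality d := rfl

/-- Along an edge, the map between fibres is `xor` with fixed bits, hence a bijection. -/
theorem twistedProj_isCartesian (s : PathSegment D X₀) : IsCartesian (twistedProj s) := by
  rw [isCartesian_iff]
  intro i j d Y
  constructor
  · rintro ⟨x, a⟩ ⟨x', a'⟩ h h'
    obtain rfl : x = x' := h'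
    refine Prod.ext rfl (funext fun g => ?_)
    have := congrFun (congrArg Prod.snd h) g
    exact Bool.xor_left_inj.1 this
  · rintro ⟨y, b⟩ x h
    obtain rfl : y = (D.map d).app Y x := h
    refine ⟨(x, fun g => xor (b g) (isMarked s d ((D.obj i).map g x))),
      Prod.ext rfl (funext fun g => ?_), rfl⟩
    change xor (xor _ _) _ = _
    simp

/-- The element of the twisted diagram over `z` with second component `a`. -/
def twistedElement (s : PathSegment D X₀) (z : Element D X₀) (a : (X₀ ⟶ X₀) → Bool) :
    Element (twistedDiagram s) X₀ := ⟨z.1, (z.2, a)⟩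

variable {K : B ⥤ Type u} (s : PathSegment D X₀) (ρ : DiagramCocone (twistedDiagram s) K)

open Classical in
-- Monodromy along one segment: only the bit at `𝟙 X₀` is tracked, and it flips exactly when `t` is
-- `s` up to reversal.
theorem exists_transport_segment (t : PathSegment D X₀) (a : (X₀ ⟶ X₀) → Bool) :
    ∃ a' : (X₀ ⟶ X₀) → Bool, coconeValue ρ (twistedElement s t.first a) =
      coconeValue ρ (twistedElement s t.third a') ∧
      a' (𝟙 X₀) = xor (a (𝟙 X₀)) (decide (WeaklyEqual s t)) := by
  obtain ⟨i, j, d, x, rfl | rfl⟩ := t.eq_edgeSegment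
  · refine ⟨fun g => xor (a g) (isMarked s d ((D.obj i).map g x)), ?_, by simp [isMarked]⟩
    exact (coconeValue_edge ρ d (X := X₀) (x, a)).symm
  · refine ⟨fun g => xor (a g) (isMarked s d ((D.obj i).map g x)), ?_,
      by simp [isMarked, weaklyEqual_reverse_right]⟩
    rw [show twistedElement s (edgeSegment D d x).reverse.first a =
      ⟨j, ((twistedDiagram s).map d).app X₀
        (x, fun g => xor (a g) (isMarked s d ((D.obj i).map g x)))⟩ from
      Sigma.ext rfl (heq_of_eq (Prod.ext rfl (funext fun g => by
        change a g = xor (xor _ _) _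
        simp)))]
    exact coconeValue_edge ρ d (X := X₀) _

theorem exists_transport {P : List (PathSegment D X₀)} {z z' : Element D X₀}
    (hP : Connects P z z') (hs : ∀ t ∈ P, ¬ WeaklyEqual s t) (a : (X₀ ⟶ X₀) → Bool) :
    ∃ a' : (X₀ ⟶ X₀) → Bool, coconeValue ρ (twistedElement s z a) =
      coconeValue ρ (twistedElement s z' a') ∧ a' (𝟙 X₀) = a (𝟙 X₀) := by
  induction P generalizing z a with
  | nil => cases hP; exact ⟨a, rfl, rfl⟩
  | cons t P ih =>
    obtain ⟨rfl, h⟩ := hP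
    obtain ⟨a₁, h₁, h₁'⟩ := exists_transport_segment s ρ t a
    obtain ⟨a₂, h₂, h₂'⟩ := ih h (fun t ht => hs t (List.mem_cons_of_mem _ ht)) a₁
    refine ⟨a₂, h₁.trans h₂, ?_⟩
    rw [h₂', h₁']
    simp [hs t List.mem_cons_self]

variable {S : B ⥤ Type u} {κ : DiagramCocone D S}

/-- If `κ` is Van Kampen, each diagram that is cartesian over `D` embeds into the pullback of a
cocone. -/
theorem IsVanKampen.exists_cocone (h : IsVanKampen κ) {E : I ⥤q (B ⥤ Type u)} (τ : E ⟶ D)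
    (hτ : IsCartesian τ) :
    ∃ (K : B ⥤ Type u) (ρ : DiagramCocone E K), ∀ (i : I) (X : B) (e e' : (E.obj i).obj X),
      (leg ρ i).app X e = (leg ρ i).app X e' → (τ.app i).app X e = (τ.app i).app X e' →
        e = e' := by
  have : (pullbackAlong κ).IsEquivalence := h
  let T : CartesianOver D := ⟨Over.mk τ, hτ⟩
  let σ := (pullbackAlong κ).objPreimage T
  let φ : (pullbackAlong κ).obj σ ≅ T := (pullbackAlong κ).objObjPreimageIso T
  let ψ : E ⟶ pullbackDiagram κ σ := φ.inv.hom.left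
  have hψ : ψ ≫ pullbackProj κ σ = τ := Over.w φ.inv.hom
  let χ : pullbackDiagram κ σ ⟶ E := φ.hom.hom.left
  have hψχ : ψ ≫ χ = 𝟙 E := congrArg (fun f => CommaMorphism.left f.hom) φ.inv_hom_id
  -- Identify `E` with the pullback of some `σ`, using essential surjectivity. An element of a
  -- pullback is determined by its two projections.
  refine ⟨σ.left, mkCocone (fun i => ψ.app i ≫ pbSnd κ σ i) fun {i j} d => ?_, ?_⟩
  · rw [← Category.assoc, ψ.naturality, Category.assoc, map_pbSnd]
  · intro i X e e' h₁ h₂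
    have hp := (pb_isPullback κ σ i).app X
    have h₃ : (ψ.app i).app X e = (ψ.app i).app X e' := by
      refine Limits.Types.ext_of_isPullback hp h₁ ?_
      rw [← hψ] at h₂
      exact h₂
    have h₄ : ∀ x, (χ.app i).app X ((ψ.app i).app X x) = x := fun x =>
      ConcreteCategory.congr_hom
        (NatTrans.congr_app (congrArg (fun f => DiagramHom.app f i) hψχ) X) x
    rw [← h₄ e, h₃, h₄]

/-- Twist along the first segment `s` of a closed trail. It flips the sheet once and properness
keeps the rest of the trail off `s`, so two distinct points of one fibre get the same cocone value.
-/
theorem IsVanKampen.noProperCycle (h : IsVanKampen κ) (X : B) : NoProperCycle D X := by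
  intro P z hP hP'
  cases P with
  | nil => rfl
  | cons s P =>
    exfalso
    obtain ⟨K, ρ, hρ⟩ := h.exists_cocone (twistedProj s) (twistedProj_isCartesian s)
    obtain ⟨rfl, hP⟩ := hP
    obtain ⟨a₁, h₁, h₁'⟩ := exists_transport_segment s ρ s fun _ => false
    obtain ⟨a₂, h₂, h₂'⟩ := exists_transport s ρ hP (List.pairwise_cons.1 hP').1 a₁
    have h₃ := congrArg Prod.snd (hρ s.first.1 X (s.first.2, fun _ => false) (s.first.2, a₂)
      (h₁.trans h₂) rfl)
    rw [h₁'] at h₂'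
    have h₄ := congrFun h₃ (𝟙 X)
    simp [WeaklyEqual] at h₂' h₄
    simp [h₂'] at h₄

end Monodromy

/-! ### Colimits of set-valued functors as path components -/

section Colimits

variable {I : Type w₁} [Quiver.{w₂} I] {B : Type u} [SmallCategory.{u} B]
  {D E : I ⥤q (B ⥤ Type u)} {X : B} {S : B ⥤ Type u} {κ : DiagramCocone D S}

/-- The functor `Y ↦ ((Y ⟶ X₀) → Prop)`, the right Kan extension of `Prop` along `X₀`. -/
def coPower (X₀ : B) : B ⥤ Type u where
  obj Y := (Y ⟶ X₀) → Prop
  map f := TypeCat.ofHom fun p g => p (f ≫ g)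
  map_id Y := by ext p; simp
  map_comp f g := by ext p; simp

theorem IsColimiting.hom_ext (hκ : IsColimiting κ) {T : B ⥤ Type u} {f g : S ⟶ T}
    (h : ∀ i, leg κ i ≫ f = leg κ i ≫ g) : f = g :=
  (hκ T (mkCocone (fun i => leg κ i ≫ g) fun d => by rw [← Category.assoc, leg_w])).unique
    h fun _ => rfl

theorem IsColimiting.exists_coconeValue_eq (hκ : IsColimiting κ) (s : S.obj X) :
    ∃ e : Element D X, coconeValue κ e = s := by
  -- Maps into `coPower X` encode predicates at sort `X`. Being in the joint image of the legs and
  -- being true agree on every leg, hence on all of `S`.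
  let f : S ⟶ coPower X :=
    { app := fun Y => TypeCat.ofHom fun s g => ∃ e : Element D X, coconeValue κ e = S.map g s
      naturality := fun Y Z f => by
        ext s
        refine funext fun g => ?_
        simp [coPower] }
  let f' : S ⟶ coPower X := { app := fun Y => TypeCat.ofHom fun s g => True }
  have h : f = f' := hκ.hom_ext fun i => by
    ext Y x
    refine funext fun g => eq_true ⟨⟨i, (D.obj i).map g x⟩, ?_⟩
    exact NatTrans.naturality_apply (leg κ i) g x
  have h' : f.app X s = f'.app X s := by rw [h]
  have hex : ∃ e : Element D X, coconeValue κ e = S.map (𝟙 X) s :=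
    of_eq_true (congrFun h' (𝟙 X))
  simpa using hex

/-- The action of a morphism of `B` on elements. -/
def actElement {Y : B} (f : X ⟶ Y) (e : Element D X) : Element D Y := ⟨e.1, (D.obj e.1).map f e.2⟩

theorem actElement_edge {Y : B} (f : X ⟶ Y) {i j : I} (d : i ⟶ j) (x : (D.obj i).obj X) :
    (edgeSegment D d ((D.obj i).map f x)).third = actElement f ⟨j, (D.map d).app X x⟩ :=
  congrArg (Sigma.mk (β := fun j => (D.obj j).obj Y) j) (NatTrans.naturality_apply (D.map d) f x)

theorem IsColimiting.exists_connects (hκ : IsColimiting κ) {z z' : Element D X}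
    (h : coconeValue κ z = coconeValue κ z') : ∃ P : List (PathSegment D X), Connects P z z' := by
  -- Reachability from `z` is invariant along segments, so this predicate factors through the
  -- colimit.
  let ρ : DiagramCocone D (coPower X) := mkCocone
    (fun i =>
      { app := fun Y => TypeCat.ofHom fun x g =>
          ∃ P : List (PathSegment D X), Connects P z ⟨i, (D.obj i).map g x⟩
        naturality := fun Y Z f => by
          ext x
          refine funext fun g => ?_
          simp [coPower] })
    (fun {i j} d => by
      ext Y x
      refine funext fun g => propext ?_
      change (∃ P : List (PathSegment D X),
          Connects P z (actElement g ⟨j, (D.map d).app Y x⟩)) ↔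
        ∃ P : List (PathSegment D X), Connects P z ⟨i, (D.obj i).map g x⟩
      rw [← actElement_edge]
      constructor
      · rintro ⟨P, hP⟩
        exact ⟨_, hP.append (connects_singleton (edgeSegment D d ((D.obj i).map g x)).reverse)⟩
      · rintro ⟨P, hP⟩
        exact ⟨_, hP.append (connects_singleton (edgeSegment D d ((D.obj i).map g x)))⟩)
  obtain ⟨f, hf, -⟩ := hκ _ ρ
  have key : ∀ y : Element D X,
      f.app X (coconeValue κ y) (𝟙 X) = ∃ P : List (PathSegment D X), Connects P z y := by
    rintro ⟨i, y⟩
    have h₁ : f.app X (coconeValue κ ⟨i, y⟩) = (leg ρ i).app X y :=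
      ConcreteCategory.congr_hom (NatTrans.congr_app (hf i) X) y
    rw [h₁]
    change (∃ P : List (PathSegment D X), Connects P z ⟨i, (D.obj i).map (𝟙 X) y⟩) = _
    simp
  rw [← key, ← h, key]
  exact ⟨[], rfl⟩

theorem coconeValue_actElement (κ : DiagramCocone D S) {Y : B} (f : X ⟶ Y) (e : Element D X) :
    coconeValue κ (actElement f e) = S.map f (coconeValue κ e) :=
  NatTrans.naturality_apply (leg κ e.1) f e.2

/-- A cocone is colimiting if it is jointly surjective and identifies connected elements only. -/
theorem isColimiting_of_connects (hs : ∀ (X : B) (s : S.obj X), ∃ e : Element D X,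
      coconeValue κ e = s)
    (hc : ∀ (X : B) (z z' : Element D X), coconeValue κ z = coconeValue κ z' →
      ∃ P : List (PathSegment D X), Connects P z z') : IsColimiting κ := by
  intro T ρ
  choose r hr using hs
  -- Cocones are constant on path components, so the chosen representatives do not matter.
  have key : ∀ {X : B} (e : Element D X),
      coconeValue ρ (r X (coconeValue κ e)) = coconeValue ρ e := fun {X} e => by
    obtain ⟨P, hP⟩ := hc X _ e (hr X (coconeValue κ e))
    exact hP.coconeValue_eq ρ
  refine ⟨{ app := fun X => TypeCat.ofHom fun s => coconeValue ρ (r X s)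
            naturality := fun X Y f => ?_ }, fun i => ?_, fun f hf => ?_⟩
  · ext s
    change coconeValue ρ (r Y (S.map f s)) = T.map f (coconeValue ρ (r X s))
    conv_lhs => rw [← hr X s, ← coconeValue_actElement, key, coconeValue_actElement]
  · ext X x
    exact key ⟨i, x⟩
  · ext X s
    change f.app X s = coconeValue ρ (r X s)
    conv_lhs => rw [← hr X s]
    exact ConcreteCategory.congr_hom (NatTrans.congr_app (hf (r X s).1) X) (r X s).2

/-- The relation on elements of being joined by a path segment. -/
def Joined (D : I ⥤q (B ⥤ Type u)) (X : B) (z z' : Element D X) : Prop :=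
  ∃ s : PathSegment D X, s.first = z ∧ s.third = z'

theorem Joined.act {Y : B} (f : X ⟶ Y) {z z' : Element D X} (h : Joined D X z z') :
    Joined D Y (actElement f z) (actElement f z') := by
  obtain ⟨s, rfl, rfl⟩ := h
  obtain ⟨i, j, d, x, rfl | rfl⟩ := s.eq_edgeSegment
  · exact ⟨edgeSegment D d ((D.obj i).map f x), rfl, actElement_edge f d x⟩
  · exact ⟨(edgeSegment D d ((D.obj i).map f x)).reverse,
      actElement_edge f d x, rfl⟩

theorem exists_connects_of_quot_eq {z z' : Element D X}
    (h : Quot.mk (Joined D X) z = Quot.mk (Joined D X) z') :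
    ∃ P : List (PathSegment D X), Connects P z z' := by
  have h' := Quot.eqvGen_exact h
  clear h
  induction h' with
  | rel _ _ h =>
    obtain ⟨s, rfl, rfl⟩ := h
    exact ⟨[s], connects_singleton s⟩
  | refl => exact ⟨[], rfl⟩
  | symm x y _ ih =>
    obtain ⟨P, hP⟩ := ih
    exact ⟨_, hP.reversePath⟩
  | trans x y z _ _ ih ih' =>
    obtain ⟨P, hP⟩ := ih
    obtain ⟨Q, hQ⟩ := ih'
    exact ⟨_, hP.append hQ⟩

/-- The colimit consists of the path components at each sort; smallness of `I` allows them to be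
shrunk into `Type u`. -/
theorem exists_isColimiting [Small.{u} I] (D : I ⥤q (B ⥤ Type u)) :
    ∃ (K : B ⥤ Type u) (ρ : DiagramCocone D K), IsColimiting ρ := by
  let K : B ⥤ Type u :=
    { obj := fun X => Shrink.{u} (Quot (Joined D X))
      map := fun f => TypeCat.ofHom fun k =>
        equivShrink _ (Quot.map (actElement f) (fun _ _ h => h.act f) ((equivShrink _).symm k))
      map_id := fun X => by
        ext k
        obtain ⟨q, rfl⟩ := (equivShrink _).surjective k
        obtain ⟨e, rfl⟩ := Quot.exists_rep q
        simp [Quot.map, actElement]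
      map_comp := fun f g => by
        ext k
        obtain ⟨q, rfl⟩ := (equivShrink _).surjective k
        obtain ⟨e, rfl⟩ := Quot.exists_rep q
        simp [Quot.map, actElement] }
  let ρ : DiagramCocone D K := mkCocone
    (fun i =>
      { app := fun X => TypeCat.ofHom fun x => equivShrink _ (Quot.mk (Joined D X) ⟨i, x⟩)
        naturality := fun X Y f => by
          ext x
          simp [K, Quot.map, actElement] })
    (fun {i j} d => by
      ext X x
      refine congrArg (equivShrink _).symm ?_
      exact congrArg (equivShrink (Quot (Joined D X)))
        (Quot.sound ⟨(edgeSegment D d x).reverse, rfl, rfl⟩))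
  refine ⟨K, ρ, isColimiting_of_connects (fun X k => ?_) fun X z z' h => ?_⟩
  · obtain ⟨q, rfl⟩ := (equivShrink _).surjective k
    obtain ⟨e, rfl⟩ := Quot.exists_rep q
    exact ⟨e, rfl⟩
  · exact exists_connects_of_quot_eq ((equivShrink _).injective h)

end Colimits

/-! ### Universality of colimits and descent along forests -/

section Descent

variable {I : Type w₁} [Quiver.{w₂} I] {B : Type u} [SmallCategory.{u} B]
  {D E : I ⥤q (B ⥤ Type u)} {X : B} {S : B ⥤ Type u} {κ : DiagramCocone D S}

/-- The cocone over the pulled back diagram. -/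
noncomputable def pullbackCocone (κ : DiagramCocone D S) (σ : Over S) :
    DiagramCocone (pullbackDiagram κ σ) σ.left :=
  mkCocone (pbSnd κ σ) (map_pbSnd κ σ)

/-- Colimits of set-valued functors are universal. -/
theorem IsColimiting.pullbackCocone (hκ : IsColimiting κ) (σ : Over S) :
    IsColimiting (pullbackCocone κ σ) := by
  refine isColimiting_of_connects (fun X k => ?_) fun X e e' h => ?_
  · obtain ⟨⟨i, z⟩, hz⟩ := hκ.exists_coconeValue_eq (σ.hom.app X k)
    obtain ⟨e, he, -⟩ := Limits.Types.exists_of_isPullback ((pb_isPullback κ σ i).app X) k z hz.symm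
    exact ⟨⟨i, e⟩, he⟩
  · have hw : ∀ e : Element (pullbackDiagram κ σ) X,
        σ.hom.app X (coconeValue (VanKampenPath.pullbackCocone κ σ) e) =
          coconeValue κ (mapElement (pullbackProj κ σ) e) := fun e =>
      ConcreteCategory.congr_hom (NatTrans.congr_app (pb_isPullback κ σ e.1).w X) e.2
    obtain ⟨P, hP⟩ := hκ.exists_connects (z := mapElement (pullbackProj κ σ) e)
      (z' := mapElement (pullbackProj κ σ) e') (by rw [← hw, ← hw, h])
    -- The lifted path ends over the same element of `D` as `e'` and with the same value in
    -- `σ.left`, hence at `e'` itself.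
    obtain ⟨Q, e'', hQ, he''⟩ := (pullbackProj_isCartesian κ σ).exists_lift e hP
    have hv := (hQ.coconeValue_eq (VanKampenPath.pullbackCocone κ σ)).symm.trans h
    suffices e'' = e' by exact ⟨Q, this ▸ hQ⟩
    obtain ⟨i, x⟩ := e'
    obtain ⟨j, y⟩ := e''
    obtain ⟨rfl, hxy⟩ := Sigma.mk.inj_iff.1 he''
    exact Sigma.ext rfl (heq_of_eq (Limits.Types.ext_of_isPullback
      ((pb_isPullback κ σ j).app X) hv (eq_of_heq hxy)))

theorem IsColimiting.faithful_pullbackAlong (hκ : IsColimiting κ) :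
    (pullbackAlong κ).Faithful where
  map_injective {σ σ'} γ γ' h := by
    ext1
    refine (hκ.pullbackCocone σ).hom_ext fun i => ?_
    have h' : pbMap κ γ i = pbMap κ γ' i :=
      congrArg (fun f => DiagramHom.app (CommaMorphism.left (InducedCategory.Hom.hom f)) i) h
    change pbSnd κ σ i ≫ γ.left = pbSnd κ σ i ≫ γ'.left
    rw [← pbMap_pbSnd, h', pbMap_pbSnd]

/-- A morphism between pulled back diagrams induces a cocone over the first one, which factors
through its colimit `σ.left`. -/
theorem IsColimiting.full_pullbackAlong (hκ : IsColimiting κ) :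
    (pullbackAlong κ).Full where
  map_surjective {σ σ'} φ := by
    let ψ : pullbackDiagram κ σ ⟶ pullbackDiagram κ σ' := φ.hom.left
    have hψ (i : I) : ψ.app i ≫ pbFst κ σ' i = pbFst κ σ i :=
      congrArg (fun f => DiagramHom.app f i) (Over.w φ.hom)
    obtain ⟨f, hf, -⟩ := hκ.pullbackCocone σ _ (mkCocone (fun i => ψ.app i ≫ pbSnd κ σ' i)
      fun d => by rw [← Category.assoc, ψ.naturality, Category.assoc, map_pbSnd])
    replace hf (i : I) : pbSnd κ σ i ≫ f = ψ.app i ≫ pbSnd κ σ' i := hf i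
    have hw : f ≫ σ'.hom = σ.hom := (hκ.pullbackCocone σ).hom_ext fun i => by
      change pbSnd κ σ i ≫ f ≫ σ'.hom = pbSnd κ σ i ≫ σ.hom
      rw [← Category.assoc, hf, Category.assoc, (pb_isPullback κ σ' i).w, ← Category.assoc, hψ,
        (pb_isPullback κ σ i).w]
    refine ⟨Over.homMk f hw, ?_⟩
    ext i : 3
    change pbMap κ (Over.homMk f hw) i = ψ.app i
    apply (pb_isPullback κ σ' i).hom_ext
    · rw [pbMap_pbSnd]; exact hf i
    · rw [pbMap_pbFst, hψ]

theorem exists_split_of_not_pairwise {α : Type*} {R : α → α → Prop} {l : List α}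
    (h : ¬ l.Pairwise R) :
    ∃ (l₁ : List α) (a : α) (l₂ : List α) (b : α) (l₃ : List α),
      l = l₁ ++ a :: (l₂ ++ b :: l₃) ∧ ¬ R a b := by
  induction l with
  | nil => exact absurd List.Pairwise.nil h
  | cons a l ih =>
    by_cases hl : l.Pairwise R
    · rw [List.pairwise_cons, and_iff_left hl] at h
      simp only [not_forall] at h
      obtain ⟨b, hb, hab⟩ := h
      obtain ⟨l₂, l₃, rfl⟩ := List.append_of_mem hb
      exact ⟨[], a, l₂, b, l₃, rfl, hab⟩
    · obtain ⟨l₁, c, l₂, b, l₃, rfl, hcb⟩ := ih hl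
      exact ⟨a :: l₁, c, l₂, b, l₃, rfl, hcb⟩

/-- Lifts of backtracking segments along a cartesian transformation backtrack. -/
theorem IsCartesian.first_eq_third {τ : E ⟶ D} (hτ : IsCartesian τ) {s t : PathSegment E X}
    (hst : s.map τ = (t.map τ).reverse) (h : s.third = t.first) : s.first = t.third := by
  have hlab : s.label = t.label.op := congrArg PathSegment.label hst
  have hfst : mapElement τ s.first = mapElement τ t.third := congrArg PathSegment.first hst
  obtain ⟨x, δ, y, hs⟩ := s
  obtain ⟨x', δ', y', ht⟩ := t
  obtain rfl : y = x' := h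
  obtain rfl : δ = δ'.op := hlab
  cases δ' with
  | fwd d =>
    obtain ⟨a, rfl, rfl⟩ := hs
    obtain ⟨b, hb, rfl⟩ := ht
    obtain rfl : a = b := eq_of_heq (Sigma.mk.inj_iff.1 hb).2
    rfl
  | bwd d =>
    obtain ⟨a, rfl, rfl⟩ := hs
    obtain ⟨b, rfl, hb⟩ := ht
    have hb' := eq_of_heq (Sigma.mk.inj_iff.1 hb).2
    have hf := eq_of_heq (Sigma.mk.inj_iff.1 hfst).2
    exact Sigma.ext rfl (heq_of_eq ((((isCartesian_iff τ).1 hτ) d X).1 a b hb' hf))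

/-- Without closed trails, cartesian transformations have trivial monodromy. -/
theorem IsCartesian.eq_of_connects {τ : E ⟶ D} (hτ : IsCartesian τ) (hD : NoProperCycle D X)
    (P : List (PathSegment E X)) {e e' : Element E X} (hP : Connects P e e')
    (he : mapElement τ e = mapElement τ e') : e = e' := by
  by_cases hp : IsProper (P.map (PathSegment.map τ))
  · have h₀ := hD _ _ (he ▸ hP.map τ) hp
    rw [List.map_eq_nil_iff] at h₀
    subst h₀
    exact hP
  · rw [IsProper, List.pairwise_map] at hp
    obtain ⟨P₁, s, P₂, t, P₃, rfl, hst⟩ := exists_split_of_not_pairwise hp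
    obtain ⟨h₁, h₂⟩ := connects_append_cons.1 hP
    obtain ⟨h₂, h₃⟩ := connects_append_cons.1 h₂
    -- Two segments of `P` lie over the same edge. In the same direction, induction closes the loop
    -- `s :: P₂`, which is cut out; in opposite directions it closes `P₂`, and then `s` and `t`
    -- cancel as a backtrack.
    rcases not_not.1 hst with hst | hst
    · have hf : s.first = t.first := hτ.eq_of_connects hD (s :: P₂) ⟨rfl, h₂⟩
        (congrArg PathSegment.first hst)
      exact hτ.eq_of_connects hD (P₁ ++ t :: P₃) (connects_append_cons.2 ⟨hf ▸ h₁, h₃⟩) he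
    · have hf : s.third = t.first := hτ.eq_of_connects hD P₂ h₂ (congrArg PathSegment.third hst)
      have hf' := hτ.first_eq_third hst hf
      exact hτ.eq_of_connects hD (P₁ ++ P₃) ((hf' ▸ h₁).append h₃) he
termination_by P.length
decreasing_by
  all_goals
    subst_vars
    simp only [List.length_append, List.length_cons]
    omega

theorem IsColimiting.essSurj_pullbackAlong [Small.{u} I] (hκ : IsColimiting κ)
    (hD : ∀ X, NoProperCycle D X) : (pullbackAlong κ).EssSurj where
  mem_essImage T := by
    obtain ⟨⟨E, ⟨⟨⟩⟩, τ⟩, hτ⟩ := T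
    change E ⟶ D at τ
    change IsCartesian τ at hτ
    obtain ⟨K, ρ, hρ⟩ := exists_isColimiting E
    obtain ⟨f, hf, -⟩ := hρ S (mkCocone (fun i => τ.app i ≫ leg κ i) fun d => by
      rw [← Category.assoc, τ.naturality, Category.assoc, leg_w])
    replace hf (i : I) : leg ρ i ≫ f = τ.app i ≫ leg κ i := hf i
    have hf' {X : B} (e : Element E X) :
        f.app X (coconeValue ρ e) = coconeValue κ (mapElement τ e) :=
      ConcreteCategory.congr_hom (NatTrans.congr_app (hf e.1) X) e.2
    -- Injectivity is trivial monodromy; existence is path lifting from any representative of `k`.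
    have hpb (i : I) : IsPullback (leg ρ i) (τ.app i) f (leg κ i) := by
      refine IsPullback.of_forall_isPullback_app fun X => ?_
      rw [Limits.Types.isPullback_iff]
      refine ⟨NatTrans.congr_app (hf i) X, fun e e' h => ?_, fun k z h => ?_⟩
      · obtain ⟨P, hP⟩ := hρ.exists_connects (z := ⟨i, e⟩) (z' := ⟨i, e'⟩) h.1
        exact eq_of_heq (Sigma.mk.inj_iff.1 (hτ.eq_of_connects (hD X) P hP
          (Sigma.ext rfl (heq_of_eq h.2)))).2
      · obtain ⟨e, rfl⟩ := hρ.exists_coconeValue_eq k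
        obtain ⟨P, hP⟩ := hκ.exists_connects (z := mapElement τ e) (z' := ⟨i, z⟩)
          ((hf' e).symm.trans h)
        obtain ⟨Q, ⟨j, e'⟩, hQ, he'⟩ := hτ.exists_lift e hP
        obtain ⟨rfl, hz⟩ := Sigma.mk.inj_iff.1 he'
        exact ⟨e', (hQ.coconeValue_eq ρ).symm, eq_of_heq hz⟩
    let σ : Over S := Over.mk f
    let α (i : I) : (pullbackDiagram κ σ).obj i ≅ E.obj i :=
      (pb_isPullback κ σ i).isoIsPullback _ _ (hpb i)
    have hα₁ (i : I) : (α i).hom ≫ leg ρ i = pbSnd κ σ i := IsPullback.isoIsPullback_hom_fst ..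
    have hα₂ (i : I) : (α i).hom ≫ τ.app i = pbFst κ σ i := IsPullback.isoIsPullback_hom_snd ..
    have hα {i j : I} (d : i ⟶ j) :
        (pullbackDiagram κ σ).map d ≫ (α j).hom = (α i).hom ≫ E.map d := by
      apply (hpb j).hom_ext
      · rw [Category.assoc, Category.assoc, hα₁, map_pbSnd, leg_w, hα₁]
      · rw [Category.assoc, Category.assoc, hα₂, map_pbFst, τ.naturality, ← Category.assoc, hα₂]
    let Φ : pullbackDiagram κ σ ≅ E :=
      { hom := { app := fun i => (α i).hom, naturality := hα }
        inv := { app := fun i => (α i).inv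
                 naturality := fun {i j} d => by
                  rw [Iso.comp_inv_eq, Category.assoc, hα, Iso.inv_hom_id_assoc] }
        hom_inv_id := by ext i : 1; exact (α i).hom_inv_id
        inv_hom_id := by ext i : 1; exact (α i).inv_hom_id }
    refine ⟨σ, ⟨ObjectProperty.isoMk _ (Over.isoMk Φ ?_)⟩⟩
    ext i : 1
    exact hα₂ i

theorem IsColimiting.isVanKampen [Small.{u} I] (hκ : IsColimiting κ)
    (hD : ∀ X, NoProperCycle D X) : IsVanKampen κ where
  faithful := hκ.faithful_pullbackAlong
  full := hκ.full_pullbackAlong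
  essSurj := hκ.essSurj_pullbackAlong hD

end Descent

end VanKampenPath

theorem corollary6p2 {B : Type u} [SmallCategory.{u} B]
    {I : Type w₁} [Quiver.{w₂} I] [Finite I] [∀ i j : I, Finite (i ⟶ j)]
    (D : I ⥤q (B ⥤ Type u)) (S : B ⥤ Type u)
    (κ : VanKampenPath.DiagramCocone D S) (hκ : VanKampenPath.IsColimiting κ) :
    List.TFAE [
      VanKampenPath.IsVanKampen κ,
      ∀ (X : B) (i j : I) (z : (D.obj i).obj X) (z' : (D.obj j).obj X),
        ¬ ∃ P Q : List (VanKampenPath.PathSegment D X),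
          VanKampenPath.Connects P ⟨i, z⟩ ⟨j, z'⟩ ∧ VanKampenPath.Connects Q ⟨i, z⟩ ⟨j, z'⟩ ∧
          VanKampenPath.IsProper P ∧ VanKampenPath.IsProper Q ∧ P ≠ Q,
      ∀ (X : B) (i j : I) (z : (D.obj i).obj X) (z' : (D.obj j).obj X),
        ¬ ∃ P Q : List (VanKampenPath.PathSegment D X),
          VanKampenPath.Connects P ⟨i, z⟩ ⟨j, z'⟩ ∧ VanKampenPath.Connects Q ⟨i, z⟩ ⟨j, z'⟩ ∧
          VanKampenPath.IsProper P ∧ VanKampenPath.IsProper Q ∧ P ≠ Q ∧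
          VanKampenPath.PathsDisjoint P Q,
      ∀ (X : B) (i j : I) (z : (D.obj i).obj X) (z' : (D.obj j).obj X),
        ¬ ∃ P Q : List (VanKampenPath.PathSegment D X),
          VanKampenPath.Connects P ⟨i, z⟩ ⟨j, z'⟩ ∧ VanKampenPath.Connects Q ⟨i, z⟩ ⟨j, z'⟩ ∧
          VanKampenPath.IsProper P ∧ VanKampenPath.IsProper Q ∧ P ≠ Q ∧
          VanKampenPath.PathsDisjoint P Q ∧
          VanKampenPath.IsInnerCycleFree P ∧ VanKampenPath.IsInnerCycleFree Q] := by
  tfae_have 1 → 2 := fun h X i j z z' ⟨P, Q, hP, hQ, hP', hQ', hne⟩ =>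
    hne ((h.noProperCycle X).eq_of_connects P Q hP hQ hP' hQ')
  tfae_have 2 → 3 := fun h X i j z z' ⟨P, Q, hP, hQ, hP', hQ', hne, _⟩ =>
    h X i j z z' ⟨P, Q, hP, hQ, hP', hQ', hne⟩
  tfae_have 3 → 4 := fun h X i j z z' ⟨P, Q, hP, hQ, hP', hQ', hne, hd, _⟩ =>
    h X i j z z' ⟨P, Q, hP, hQ, hP', hQ', hne, hd⟩
  tfae_have 4 → 1 := by
    have : Small.{u} I := Countable.toSmall I
    refine fun h => hκ.isVanKampen fun X P z hP hP' => ?_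
    by_contra hne
    obtain ⟨Q, y, hQ, hQ', hQne, hQc⟩ :=
      VanKampenPath.exists_isInnerCycleFree P hP hP' hne
    -- The empty path is parallel to the closed trail `Q`, and vacuously proper, disjoint from `Q`
    -- and inner-cycle free.
    exact h X y.1 y.1 y.2 y.2 ⟨[], Q, rfl, hQ, List.Pairwise.nil, hQ', hQne.symm,
      fun s hs => absurd hs List.not_mem_nil, fun i j hij hj => by simp at hj; omega, hQc⟩
  tfae_finish
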